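/- Let $G^*$ be a finite $k$-uniform hypergraph, $k\ge 2$, without repeated edges and of order $n$ (that is, with $n$ vertices $v_1,\dots,v_n$, every edge being a set of exactly $k$ vertices). Let $A(G^*)=(a_{ij})$ be its adjacency matrix, the $n\times n$ matrix in which $a_{ij}$ is the number of edges containing both $v_i$ and $v_j$ if $i\ne j$, and $a_{ii}=0$. Let $\lambda_1\ge\lambda_2\ge\cdots\ge\lambda_n$ be the eigenvalues of $A(G^*)$, counted with multiplicity, and let $\theta$ be the number of those that are negative, again counted with multiplicity. Then for every integer $t$ with $2\le t\le n$, \[ \sum_{i=1}^{t}\lambda_i\;\le\;\frac{n\binom{n-2}{k-2}}{2\theta+1}\left(\theta+\sqrt{\theta\,(t\theta+t-1)}\right). \] -/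

import Mathlib

noncomputable section

namespace Hypergraph

variable {α : Type*}

/-- A hypergraph is `k`-uniform if each of its edges contains exactly `k` vertices.
(Mathlib's hypergraphs have a set of edges, so there are no repeated edges.) -/
def IsUniform (H : Hypergraph α) (k : ℕ) : Prop :=
  ∀ e ∈ H.edgeSet, e.Finite ∧ e.ncard = k

open Classical in
/-- The adjacency matrix of a hypergraph, indexed by its vertices: the entry at two distinct
vertices `u`, `v` is the number of edges that contain both, and the diagonal is zero. -/
def adjMatrix (H : Hypergraph α) : Matrix H.vertexSet H.vertexSet ℝ :=
  Matrix.of fun u v =>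
    if u = v then 0 else (({e ∈ H.edgeSet | {(u : α), (v : α)} ⊆ e}.ncard : ℕ) : ℝ)

theorem adjMatrix_isHermitian (H : Hypergraph α) : H.adjMatrix.IsHermitian := by
  ext u v
  by_cases h : u = v
  · simp [adjMatrix, h]
  · simp [adjMatrix, h, Ne.symm h, Set.pair_comm (v : α) (u : α)]

open Classical in
/-- The eigenvalues of the adjacency matrix, counted with multiplicity and listed in
non-increasing order: the value at the index `i` is the `(i + 1)`-st largest eigenvalue. -/
def adjEigenvalues (H : Hypergraph α) [Fintype H.vertexSet] :
    Fin (Fintype.card H.vertexSet) → ℝ :=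
  H.adjMatrix_isHermitian.eigenvalues₀

/-- The number of negative eigenvalues of the adjacency matrix, counted with multiplicity. -/
def numNegEigenvalues (H : Hypergraph α) [Fintype H.vertexSet] : ℕ :=
  Fintype.card {i : Fin (Fintype.card H.vertexSet) // H.adjEigenvalues i < 0}

end Hypergraph

end

namespace Matrix.IsHermitian

variable {m : Type*} [Fintype m] [DecidableEq m] {A : Matrix m m ℝ}

/-! Write x = λ₁ and c = n·C(n-2, k-2). Entries of A lie in [0, C(n-2, k-2)], so ∑ λᵢ² = tr A² is at
most C(n-2, k-2) times the entry sum, which the Rayleigh bound puts below n·x; hence ∑ λᵢ² ≤ c·x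
(`sum_sq_eigenvalues_le`). Let p and q be the square sums of the nonnegative values among λ₂, …, λ_t
and of the negative eigenvalues, and y the sum of the former. Trace zero and Cauchy–Schwarz give x²
≤ θq and y² ≤ (t-1)p (`exists_sum_sq_split`). Eliminating p and q confines (x, y) to an ellipse, on
which x + y is maximised (`add_le_of_quadratic_constraints`). -/

theorem sum_comp_eigenvalues_eq (hA : A.IsHermitian) (f : ℝ → ℝ) :
    ∑ i, f (hA.eigenvalues i) = ∑ i, f (hA.eigenvalues₀ i) :=
  Equiv.sum_comp (Fintype.equivOfCardEq (Fintype.card_fin _)).symm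
    fun i => f (hA.eigenvalues₀ i)

theorem eq_unitary_mul_diagonal_mul_transpose (hA : A.IsHermitian) :
    A = (hA.eigenvectorUnitary : Matrix m m ℝ) * diagonal hA.eigenvalues *
      (hA.eigenvectorUnitary : Matrix m m ℝ)ᵀ := by
  have h := hA.spectral_theorem
  rw [Unitary.conjStarAlgAut_apply] at h
  exact h

theorem transpose_eigenvectorUnitary_mul_self (hA : A.IsHermitian) :
    (hA.eigenvectorUnitary : Matrix m m ℝ)ᵀ * (hA.eigenvectorUnitary : Matrix m m ℝ) = 1 :=
  Unitary.coe_star_mul_self hA.eigenvectorUnitary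

theorem eigenvectorUnitary_mul_transpose_self (hA : A.IsHermitian) :
    (hA.eigenvectorUnitary : Matrix m m ℝ) * (hA.eigenvectorUnitary : Matrix m m ℝ)ᵀ = 1 :=
  Unitary.coe_mul_star_self hA.eigenvectorUnitary

theorem sum_sq_eigenvalues (hA : A.IsHermitian) :
    ∑ i, hA.eigenvalues i ^ 2 = ∑ i, ∑ j, A i j ^ 2 := by
  have h1 : (A * A).trace = ∑ i, ∑ j, A i j ^ 2 := by
    simp only [trace, diag_apply, mul_apply]
    refine Finset.sum_congr rfl fun i _ => Finset.sum_congr rfl fun j _ => ?_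
    have h := hA.apply i j
    simp only [star_trivial] at h
    rw [h, sq]
  rw [← h1]
  have hU := hA.transpose_eigenvectorUnitary_mul_self
  have hA' := hA.eq_unitary_mul_diagonal_mul_transpose
  set U := (hA.eigenvectorUnitary : Matrix m m ℝ)
  set D := diagonal hA.eigenvalues with hD
  have h2 : A * A = U * (D * D) * Uᵀ := by
    calc A * A = (U * D * Uᵀ) * (U * D * Uᵀ) := by rw [← hA']
      _ = U * D * (Uᵀ * U) * D * Uᵀ := by simp only [Matrix.mul_assoc]
      _ = U * (D * D) * Uᵀ := by rw [hU]; simp only [Matrix.mul_assoc, Matrix.one_mul]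
  rw [h2, trace_mul_comm, ← Matrix.mul_assoc, hU, Matrix.one_mul, hD, diagonal_mul_diagonal,
    trace_diagonal]
  simp only [sq]

/-- In eigenvector coordinates the form is a combination of squares weighted by the eigenvalues. -/
theorem dotProduct_mulVec_le (hA : A.IsHermitian) {c : ℝ} (hc : ∀ i, hA.eigenvalues i ≤ c)
    (v : m → ℝ) : v ⬝ᵥ A *ᵥ v ≤ c * (v ⬝ᵥ v) := by
  have hU := hA.eigenvectorUnitary_mul_transpose_self
  have hA' := hA.eq_unitary_mul_diagonal_mul_transpose
  set U := (hA.eigenvectorUnitary : Matrix m m ℝ)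
  have h1 : v ⬝ᵥ A *ᵥ v = (Uᵀ *ᵥ v) ⬝ᵥ diagonal hA.eigenvalues *ᵥ (Uᵀ *ᵥ v) := by
    conv_lhs => rw [hA']
    rw [← mulVec_mulVec, ← mulVec_mulVec, dotProduct_mulVec, ← mulVec_transpose]
  have h2 : v ⬝ᵥ v = (Uᵀ *ᵥ v) ⬝ᵥ (Uᵀ *ᵥ v) := by
    rw [dotProduct_mulVec, ← mulVec_transpose, transpose_transpose, mulVec_mulVec, hU, one_mulVec]
  rw [h1, h2, dotProduct, dotProduct, Finset.mul_sum]
  refine Finset.sum_le_sum fun i _ => ?_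
  rw [mulVec_diagonal]
  nlinarith [hc i, mul_self_nonneg ((Uᵀ *ᵥ v) i)]

/-- For a symmetric matrix with entries in `[0, c]`, the sum of the squares of the eigenvalues is
at most `c` times the order times any upper bound of the eigenvalues. -/
theorem sum_sq_eigenvalues_le (hA : A.IsHermitian) {b c : ℝ} (hc : 0 ≤ c)
    (h0 : ∀ i j, 0 ≤ A i j) (hAc : ∀ i j, A i j ≤ c) (hb : ∀ i, hA.eigenvalues i ≤ b) :
    ∑ i, hA.eigenvalues i ^ 2 ≤ Fintype.card m * c * b := by
  -- On the all-ones vector the quadratic form is the sum of all entries.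
  have h1 := hA.dotProduct_mulVec_le hb 1
  have h2 : (1 : m → ℝ) ⬝ᵥ A *ᵥ 1 = ∑ i, ∑ j, A i j := by
    simp [dotProduct, mulVec]
  have h3 : (1 : m → ℝ) ⬝ᵥ 1 = Fintype.card m := by simp
  rw [h2, h3] at h1
  rw [hA.sum_sq_eigenvalues]
  calc ∑ i, ∑ j, A i j ^ 2 ≤ ∑ i, ∑ j, c * A i j :=
        Finset.sum_le_sum fun i _ => Finset.sum_le_sum fun j _ => by
          nlinarith [h0 i j, hAc i j]
    _ = c * ∑ i, ∑ j, A i j := by simp only [Finset.mul_sum]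
    _ ≤ c * (b * Fintype.card m) := mul_le_mul_of_nonneg_left h1 hc
    _ = Fintype.card m * c * b := by ring

end Matrix.IsHermitian

/-- The sum of the squares of a family of reals with sum zero bounds the square of any `a i₀`
together with the contributions of the negative members and of any set not containing `i₀`. -/
theorem exists_sum_sq_split {ι : Type*} [Fintype ι] [DecidableEq ι] (a : ι → ℝ)
    (hsum : ∑ i, a i = 0) {i₀ : ι} (h0 : 0 ≤ a i₀) {s : Finset ι} (hs : i₀ ∉ s) :
    ∃ y p q : ℝ, 0 ≤ q ∧ ∑ i ∈ s, a i ≤ y ∧ y ^ 2 ≤ s.card * p ∧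
      a i₀ ^ 2 ≤ (Finset.univ.filter fun i => a i < 0).card * q ∧
      a i₀ ^ 2 + p + q ≤ ∑ i, a i ^ 2 := by
  set N := Finset.univ.filter fun i => a i < 0 with hN
  -- Discarding negative members only raises the sum over `s`, and makes the index sets behind `p`
  -- and `q` disjoint.
  set P := s.filter fun i => 0 ≤ a i with hP
  refine ⟨∑ i ∈ P, a i, ∑ i ∈ P, a i ^ 2, ∑ i ∈ N, a i ^ 2, ?_, ?_, ?_, ?_, ?_⟩
  · exact Finset.sum_nonneg fun i _ => sq_nonneg _
  · rw [hP, Finset.sum_filter]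
    refine Finset.sum_le_sum fun i _ => ?_
    split_ifs with h
    · exact le_rfl
    · exact (not_le.1 h).le
  · refine sq_sum_le_card_mul_sum_sq.trans ?_
    refine mul_le_mul_of_nonneg_right ?_ (Finset.sum_nonneg fun i _ => sq_nonneg _)
    exact_mod_cast Finset.card_filter_le _ _
  · refine le_trans ?_ sq_sum_le_card_mul_sum_sq
    -- As the total is zero, `a i₀` is at most the absolute value of the negative part.
    have h1 : ∑ i ∈ N, a i + ∑ i with ¬ a i < 0, a i = 0 := by
      rw [hN, Finset.sum_filter_add_sum_filter_not, hsum]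
    have h2 : a i₀ ≤ ∑ i with ¬ a i < 0, a i :=
      Finset.single_le_sum (f := a) (fun i hi => not_lt.1 (Finset.mem_filter.1 hi).2)
        (Finset.mem_filter.2 ⟨Finset.mem_univ _, not_lt.2 h0⟩)
    nlinarith
  · have hd : Disjoint P N := Finset.disjoint_left.2 fun i hi hi' =>
      absurd (Finset.mem_filter.1 hi).2 (not_le.2 (Finset.mem_filter.1 hi').2)
    have hn : i₀ ∉ P ∪ N := by
      simp [hP, hN, hs, h0]
    rw [add_assoc, ← Finset.sum_union hd, ← Finset.sum_insert (f := fun i => a i ^ 2) hn]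
    exact Finset.sum_le_sum_of_subset_of_nonneg (Finset.subset_univ _) fun i _ _ => sq_nonneg _

theorem add_le_of_quadratic_constraints {x y p q c θ t : ℝ} (hx : 0 ≤ x) (hc : 0 ≤ c)
    (hθ : 0 ≤ θ) (ht : 1 < t) (hq0 : 0 ≤ q) (hy : y ^ 2 ≤ (t - 1) * p) (hq : x ^ 2 ≤ θ * q)
    (h : x ^ 2 + p + q ≤ c * x) :
    x + y ≤ c / (2 * θ + 1) * (θ + √(θ * (t * θ + t - 1))) := by
  have hm : 0 < t - 1 := sub_pos.2 ht
  have hD : 0 ≤ t * θ + t - 1 := by nlinarith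
  set R := √(θ * (t * θ + t - 1)) with hR
  have hR0 : 0 ≤ R := Real.sqrt_nonneg _
  have hR2 : R ^ 2 = θ * (t * θ + t - 1) := Real.sq_sqrt (mul_nonneg hθ hD)
  -- The argument yields the larger denominator 2(θ+1), a sharper bound than the one claimed.
  suffices hs : 2 * (θ + 1) * (x + y) ≤ c * (θ + R) by
    rw [div_mul_eq_mul_div, le_div_iff₀ (by positivity)]
    have : 0 ≤ c * (θ + R) := by positivity
    rcases le_total 0 (x + y) with h' | h' <;> nlinarith
  -- For θ = 0 the ellipse inequality no longer constrains y, but the hypotheses force x = y = 0.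
  rcases hθ.eq_or_lt with rfl | hθ
  · have hx0 : x = 0 := by nlinarith
    subst hx0
    have hy0 : y ^ 2 ≤ 0 := by nlinarith
    rw [pow_eq_zero_iff two_ne_zero |>.1 (le_antisymm hy0 (sq_nonneg y))]
    simp only [add_zero, mul_zero, zero_add]
    positivity
  have h1 : (t - 1) * (θ + 1) * x ^ 2 + θ * y ^ 2 ≤ (t - 1) * θ * (c * x) := by
    have e1 := mul_le_mul_of_nonneg_left h (mul_pos hm hθ).le
    have e2 := mul_le_mul_of_nonneg_left hy hθ.le
    have e3 := mul_le_mul_of_nonneg_left hq hm.le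
    linarith
  -- Completing the square: u and v are scaled coordinates centred on the ellipse.
  set u := 2 * (θ + 1) * x - c * θ with hu
  set v := 2 * (θ + 1) * y with hv
  have h2 : (θ + 1) * (t - 1) * u ^ 2 + θ * v ^ 2 ≤ (θ + 1) * (t - 1) * (c * θ) ^ 2 := by
    have e := mul_le_mul_of_nonneg_left h1 (by positivity : (0 : ℝ) ≤ 4 * (θ + 1) ^ 2)
    rw [hu, hv]
    linarith
  have hK : 0 < (θ + 1) * (t - 1) * θ := by positivity
  have h3 : (u + v) ^ 2 ≤ (c * R) ^ 2 := by
    rw [mul_pow, hR2]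
    refine le_of_mul_le_mul_left ?_ hK
    have e := mul_le_mul_of_nonneg_right h2 hD
    -- Weighted Cauchy–Schwarz: with α = (θ+1)(t-1) and β = θ, this square is (α+β)(αu²+βv²) -
    -- αβ(u+v)², and α+β = tθ+t-1.
    have e' := sq_nonneg ((θ + 1) * (t - 1) * u - θ * v)
    linarith
  have h4 : u + v ≤ c * R := (abs_le_of_sq_le_sq' h3 (by positivity)).2
  rw [hu, hv] at h4
  linarith

namespace Hypergraph

variable {α : Type*}

/-- Removing u and v maps these edges injectively to (k-2)-subsets of the other vertices. -/
theorem IsUniform.ncard_edges_containing_pair_le {H : Hypergraph α} [Fintype H.vertexSet] {k : ℕ}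
    (hH : H.IsUniform k) {u v : α} (hu : u ∈ H.vertexSet) (hv : v ∈ H.vertexSet) (huv : u ≠ v) :
    {e ∈ H.edgeSet | {u, v} ⊆ e}.ncard ≤
      (Fintype.card H.vertexSet - 2).choose (k - 2) := by
  classical
  set V := H.vertexSet.toFinset with hV
  set W := V \ {u, v} with hW
  have hsub : ({u, v} : Finset α) ⊆ V := by
    simp [hV, Set.insert_subset_iff, hu, hv]
  have hWc : W.card = Fintype.card H.vertexSet - 2 := by
    rw [hW, Finset.card_sdiff_of_subset hsub, Finset.card_pair huv, hV, Set.toFinset_card]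
  rw [← hWc, ← Finset.card_powersetCard, ← Set.ncard_coe_finset]
  have hmem : ∀ e ∈ H.edgeSet, ∀ x, x ∈ W.filter (· ∈ e) ↔ x ∈ e ∧ x ≠ u ∧ x ≠ v := by
    intro e he x
    have := @H.subset_vertexSet_of_mem_edgeSet' e he x
    simp [hW, hV]
    tauto
  refine Set.ncard_le_ncard_of_injOn (fun e => W.filter (· ∈ e)) ?_ ?_ (Finset.finite_toSet _)
  · rintro e ⟨he, hs⟩
    obtain ⟨hfin, hcard⟩ := hH e he
    rw [Finset.mem_coe, Finset.mem_powersetCard]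
    refine ⟨Finset.filter_subset _ _, ?_⟩
    have h1 : ((W.filter (· ∈ e) : Finset α) : Set α) = e \ {u, v} := by
      ext x
      rw [Finset.mem_coe, hmem e he]
      simp
    rw [← Set.ncard_coe_finset, h1, Set.ncard_sdiff hs (Set.toFinite _), hcard, Set.ncard_pair huv]
  · rintro e ⟨he, hs⟩ f ⟨hf, hs'⟩ hef
    ext x
    have h1 := hmem e he x
    have h2 := hmem f hf x
    rw [show W.filter (· ∈ e) = W.filter (· ∈ f) from hef] at h1
    have h3 := h1.symm.trans h2
    by_cases hxu : x = u
    · subst hxu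
      exact iff_of_true (hs (by simp)) (hs' (by simp))
    by_cases hxv : x = v
    · subst hxv
      exact iff_of_true (hs (by simp)) (hs' (by simp))
    simpa [hxu, hxv] using h3

theorem adjMatrix_nonneg (H : Hypergraph α) (u v : H.vertexSet) : 0 ≤ H.adjMatrix u v := by
  rw [adjMatrix, Matrix.of_apply]
  split_ifs <;> positivity

theorem IsUniform.adjMatrix_le {H : Hypergraph α} [Fintype H.vertexSet] {k : ℕ}
    (hH : H.IsUniform k) (u v : H.vertexSet) :
    H.adjMatrix u v ≤ ((Fintype.card H.vertexSet - 2).choose (k - 2) : ℕ) := by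
  rw [adjMatrix, Matrix.of_apply]
  split_ifs with h
  · positivity
  · exact_mod_cast hH.ncard_edges_containing_pair_le u.2 v.2 fun h' => h (Subtype.ext h')

theorem adjEigenvalues_antitone (H : Hypergraph α) [Fintype H.vertexSet] :
    Antitone H.adjEigenvalues := by
  classical
  exact H.adjMatrix_isHermitian.eigenvalues₀_antitone

theorem sum_adjEigenvalues (H : Hypergraph α) [Fintype H.vertexSet] :
    ∑ i, H.adjEigenvalues i = 0 := by
  classical
  have h := H.adjMatrix_isHermitian.trace_eq_sum_eigenvalues
  have h0 : H.adjMatrix.trace = 0 := by simp [Matrix.trace, adjMatrix]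
  rw [h0] at h
  have h1 := H.adjMatrix_isHermitian.sum_comp_eigenvalues_eq id
  simp only [id, RCLike.ofReal_real_eq_id] at h h1
  rw [← h] at h1
  exact h1.symm

theorem IsUniform.sum_sq_adjEigenvalues_le {H : Hypergraph α} [Fintype H.vertexSet] {k : ℕ}
    (hH : H.IsUniform k) {b : ℝ} (hb : ∀ i, H.adjEigenvalues i ≤ b) :
    ∑ i, H.adjEigenvalues i ^ 2 ≤
      Fintype.card H.vertexSet * ((Fintype.card H.vertexSet - 2).choose (k - 2) : ℕ) * b := by
  classical
  have h := H.adjMatrix_isHermitian.sum_sq_eigenvalues_le (b := b) (Nat.cast_nonneg _)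
    H.adjMatrix_nonneg hH.adjMatrix_le fun i => hb _
  rw [H.adjMatrix_isHermitian.sum_comp_eigenvalues_eq (· ^ 2)] at h
  exact h

end Hypergraph

theorem corollary3p2 {α : Type*} (H : Hypergraph α) [Fintype H.vertexSet]
    (n k t θ : ℕ) (hn : Fintype.card H.vertexSet = n)
    (hk : 2 ≤ k) (hH : H.IsUniform k)
    (ht : 2 ≤ t) (htn : t ≤ n)
    (hθ : H.numNegEigenvalues = θ) :
    ∑ i : Fin t, H.adjEigenvalues (Fin.castLE (htn.trans hn.ge) i) ≤
      (n : ℝ) * ((n - 2).choose (k - 2) : ℝ) / (2 * (θ : ℝ) + 1) *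
        ((θ : ℝ) + √((θ : ℝ) * ((t : ℝ) * (θ : ℝ) + (t : ℝ) - 1))) := by
  classical
  obtain ⟨r, rfl⟩ : ∃ r, t = r + 1 := ⟨t - 1, by omega⟩
  subst hn
  set a := H.adjEigenvalues with ha
  set i₀ : Fin (Fintype.card H.vertexSet) := ⟨0, by omega⟩ with hi₀
  have hmax : ∀ i, a i ≤ a i₀ := fun i => H.adjEigenvalues_antitone (Nat.zero_le _)
  have h0 : 0 ≤ a i₀ := by
    by_contra! hneg
    have := Finset.sum_neg (fun i _ => (hmax i).trans_lt hneg) ⟨i₀, Finset.mem_univ i₀⟩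
    exact this.ne H.sum_adjEigenvalues
  -- Indices start at 0, so `emb` picks out λ₂, …, λ_t, where t = r + 1.
  set emb : Fin r ↪ Fin (Fintype.card H.vertexSet) :=
    (Fin.succEmb r).trans (Fin.castLEEmb htn) with hemb
  have hi : i₀ ∉ Finset.univ.map emb := by
    simp [hemb, hi₀, Fin.ext_iff]
  obtain ⟨y, p, q, hq0, hy, hp, hq, hpq⟩ := exists_sum_sq_split a H.sum_adjEigenvalues h0 hi
  have hθ' : (Finset.univ.filter fun i => a i < 0).card = θ := by
    exact (Fintype.card_subtype _).symm.trans hθ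
  rw [hθ'] at hq
  rw [Finset.card_map, Finset.card_univ, Fintype.card_fin] at hp
  rw [Finset.sum_map] at hy
  have hsum : ∑ i : Fin (r + 1), a (Fin.castLE htn i) = a i₀ + ∑ i, a (emb i) := by
    rw [Fin.sum_univ_succ]
    rfl
  refine hsum.le.trans ((add_le_add_right hy _).trans ?_)
  refine add_le_of_quadratic_constraints (p := p) (q := q) h0 (by positivity) (by positivity) ?_
    hq0 ?_ hq (hpq.trans (hH.sum_sq_adjEigenvalues_le hmax))
  · exact_mod_cast ht
  · push_cast
    linarith
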